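/- **Setting.** Let $\Sigma$ be a finite alphabet and $\mathcal R$ a reflexive symmetric relation on $\Sigma$. Let $\mathcal M_\Sigma=\langle \Sigma\mid ab=ba \text{ for } (a,b)\notin\mathcal R\rangle$ be the corresponding trace monoid, with unit $\mathbf e$. Write $|x|$ for the length of a trace $x$ and $|x|_a$ for its number of occurrences of the letter $a$. Let $\max(x)$ be the set of letters $b$ such that $x=y\cdot b$ for some $y\in\mathcal M_\Sigma$. For $S\subseteq\Sigma$ let $\mathcal M_S$ be the submonoid generated by $S$, and let $\mu_S(X)=\sum_{\gamma}(-1)^{|\gamma|}X^{|\gamma|}$ be its Möbius polynomial, where $\gamma$ ranges over the sets of letters of $S$ such that $(a,b)\notin\mathcal R$ for all distinct $a,b\in\gamma$. Let $p_\Sigma$ be the root of smallest modulus of $\mu_\Sigma$ in $\mathbb C$ (it is unique, real and positive). For $a\in\Sigma$ put $\mathscr L(a)=\{b\in\Sigma : (a,b)\in\mathcal R\}$. Let $p\in(0,p_\Sigma)$. For $S\subseteq \Sigma$, let $B_{S,p}$ be the probability distribution on $\mathcal M_S$ given by $B_{S,p}(x)=\mu_S(p)\,p^{|x|}$. For $T\subseteq\Sigma$,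 let $D_{S,T}=B_{S,p}(\,\cdot\mid \max(\xi)\subseteq T)$ be its conditional law given that $\max(\xi)\subseteq T$. A trace is $a_1$-pyramidal if it is of the form $z\cdot a_1$ with $z\in\mathcal M_{\Sigma\setminus\{a_1\}}$ and $\max(z)\subseteq\mathscr L(a_1)$; one then writes $z=(z\cdot a_1)\cdot a_1^{-1}$. Every trace $x\in\mathcal M_\Sigma$ has a unique factorization $x=u_0\cdot\ldots\cdot u_{k-1}\cdot u_k$ with $k\ge 0$, with $u_0,\dots,u_{k-1}$ $a_1$-pyramidal and with $u_k\in\mathcal M_{\Sigma\setminus\{a_1\}}$, and then $k=|x|_{a_1}$. **Theorem.** Let $p\in(0,p_\Sigma)$ and $a_1\in\Sigma$. Then $\mu_{\Sigma\setminus\{a_1\}}(p)>0$, and one may define the real number $$r=p\,\frac{\mu_{\Sigma\setminus\mathscr L(a_1)}(p)}{\mu_{\Sigma\setminus\{a_1\}}(p)}=1-\frac{\mu_\Sigma(p)}{\mu_{\Sigma\setminus\{a_1\}}(p)}.$$ Furthermore, let $T\subseteq\Sigma$ with $a_1\in T$, and let $\xi=U_0\cdot\ldots\cdot U_K$ be the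 above factorization of a random trace $\xi$ with law $D_{\Sigma,T}$. Then: 1. The random variable $K=|\xi|_{a_1}$ is geometric with parameter $r$: $\Pr(K=k)=(1-r)\,r^k$ for every integer $k\ge 0$. 2. For every integer $k\geq 0$, conditionally on $\{K=k\}$: (a) the variables $U_0,\dots,U_{k-1},U_k$ are independent; (b) each of the variables $U_0\cdot a_1^{-1},\dots,U_{k-1}\cdot a_1^{-1}$ has law $D_{\Sigma\setminus\{a_1\},\mathscr L(a_1)}$ on $\mathcal M_{\Sigma\setminus\{a_1\}}$; (c) the variable $U_k$ has law $D_{\Sigma\setminus\{a_1\},T}$ on $\mathcal M_{\Sigma\setminus\{a_1\}}$. -/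

import Mathlib

open MeasureTheory ProbabilityTheory Polynomial

noncomputable section

namespace TraceMonoid

variable {S : Type*}

/-- Elementary commutations: the words `ab` and `ba` are identified when `(a, b) ∉ R`. -/
def CommRel (R : S → S → Prop) (u v : FreeMonoid S) : Prop :=
  ∃ a b : S, ¬ R a b ∧ u = FreeMonoid.of a * FreeMonoid.of b ∧
    v = FreeMonoid.of b * FreeMonoid.of a

/-- The trace monoid `M(S, R) = ⟨S | ab = ba for (a, b) ∉ R⟩`. -/
abbrev Trace (R : S → S → Prop) : Type _ := PresentedMonoid (CommRel R)

/-- The countable set of traces carries the discrete `σ`-algebra. -/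
instance (R : S → S → Prop) : MeasurableSpace (Trace R) := ⊤

instance (R : S → S → Prop) : DiscreteMeasurableSpace (Trace R) := ⟨fun _ => trivial⟩

/-- A letter, seen as a trace. -/
def letter (R : S → S → Prop) (a : S) : Trace R := PresentedMonoid.of (CommRel R) a

/-- The length `|x|`, as a monoid morphism. -/
def lengthHom (R : S → S → Prop) : Trace R →* Multiplicative ℕ :=
  PresentedMonoid.lift (fun _ => Multiplicative.ofAdd 1) (by
    rintro _ _ ⟨a, b, -, rfl, rfl⟩
    simp only [map_mul]
    exact mul_comm _ _)

/-- The length `|x|` of a trace. -/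
def length {R : S → S → Prop} (x : Trace R) : ℕ := (lengthHom R x).toAdd

open Classical in
/-- The number of occurrences of the letter `a`, as a monoid morphism. -/
def countHom (R : S → S → Prop) (a : S) : Trace R →* Multiplicative ℕ :=
  PresentedMonoid.lift (fun b => Multiplicative.ofAdd (if b = a then 1 else 0)) (by
    rintro _ _ ⟨b, c, -, rfl, rfl⟩
    simp only [map_mul]
    exact mul_comm _ _)

/-- The number `|x|_a` of occurrences of the letter `a` in the trace `x`. -/
def count {R : S → S → Prop} (a : S) (x : Trace R) : ℕ := (countHom R a x).toAdd

/-- `max(x)`: the letters that can stand at the end of a word representing `x`. -/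
def maxLetters {R : S → S → Prop} (x : Trace R) : Set S :=
  {b | ∃ y : Trace R, x = y * letter R b}

/-- The submonoid `M_{S'}` generated by the letters of `S'`. -/
def sub (R : S → S → Prop) (S' : Set S) : Submonoid (Trace R) :=
  Submonoid.closure (letter R '' S')

/-- The link of the letter `a`. -/
def link (R : S → S → Prop) (a : S) : Set S := {b | R a b}

open Classical in
/-- The Möbius polynomial `μ_{S'}(X) = ∑_γ (-1)^|γ| X^|γ|`, where `γ` ranges over the cliques
of `M_{S'}`; a clique is represented by its set of (pairwise distinct and pairwise
independent) letters. -/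
def mobius [Fintype S] (R : S → S → Prop) (S' : Set S) : ℤ[X] :=
  ∑ γ ∈ (Finset.univ : Finset (Finset S)).filter
      (fun γ : Finset S => (γ : Set S) ⊆ S' ∧ (γ : Set S).Pairwise (fun a b => ¬ R a b)),
    (-1) ^ γ.card * X ^ γ.card

/-- The value `μ_{S'}(p)` at a real number `p`. -/
def mobiusVal [Fintype S] (R : S → S → Prop) (S' : Set S) (p : ℝ) : ℝ :=
  aeval p (mobius R S')

/-- `p_S`, the smallest modulus of a complex root of the Möbius polynomial `μ_S`. -/
def minRoot [Fintype S] (R : S → S → Prop) : ℝ :=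
  sInf {ρ : ℝ | ∃ z : ℂ, aeval z (mobius R Set.univ) = 0 ∧ ρ = ‖z‖}

/-- The distribution `B_{S',p}` on `M_{S'}`, with `B_{S',p}(x) = μ_{S'}(p) p^|x|`, seen as a
measure on the set of all traces. -/
def lawB [Fintype S] (R : S → S → Prop) (p : ℝ) (S' : Set S) : Measure (Trace R) :=
  Measure.sum fun x : sub R S' =>
    ENNReal.ofReal (mobiusVal R S' p * p ^ length (x : Trace R)) • Measure.dirac (x : Trace R)

/-- The distribution `D_{S',T} = B_{S',p}( · | max(ξ) ⊆ T)`. -/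
def lawD [Fintype S] (R : S → S → Prop) (p : ℝ) (S' T : Set S) : Measure (Trace R) :=
  (lawB R p S')[|{x | maxLetters x ⊆ T}]

/-- The `a`-pyramidal traces: `z · a` with `z ∈ M_{S \ {a}}` and `max(z)` in the link of `a`. -/
def Pyr (R : S → S → Prop) (a : S) : Set (Trace R) :=
  {u | ∃ z ∈ sub R {a}ᶜ, maxLetters z ⊆ link R a ∧ u = z * letter R a}

/-- `f = ([u₀, …, u_{k-1}], u_k)` is a factorization `x = u₀ ⋯ u_{k-1} u_k` of `x` in which
`u₀, …, u_{k-1}` are `a`-pyramidal and `u_k ∈ M_{S \ {a}}`. -/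
def IsPyrFact {R : S → S → Prop} (a : S) (x : Trace R) (f : List (Trace R) × Trace R) : Prop :=
  (∀ u ∈ f.1, u ∈ Pyr R a) ∧ f.2 ∈ sub R {a}ᶜ ∧ x = f.1.prod * f.2

open Classical in
/-- The factorization of `x` through `a`-pyramidal traces. -/
def pyrFact {R : S → S → Prop} (a : S) (x : Trace R) : List (Trace R) × Trace R :=
  if h : ∃ f, IsPyrFact a x f then h.choose else ([], 1)

/-- `K`: the number of `a`-pyramidal factors in the factorization of `x`. -/
def pyrK {R : S → S → Prop} (a : S) (x : Trace R) : ℕ := (pyrFact a x).1.length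

/-- `U_i`: the factor with index `i` in the factorization `x = U₀ ⋯ U_K`, the last factor `U_K`
included (and the empty trace for `i > K`). -/
def pyrU {R : S → S → Prop} (a : S) (i : ℕ) (x : Trace R) : Trace R :=
  ((pyrFact a x).1 ++ [(pyrFact a x).2]).getD i 1

open Classical in
/-- `u · a⁻¹`: the trace `z` with `u = z · a` (and the empty trace if there is none). -/
def removeLast {R : S → S → Prop} (a : S) (u : Trace R) : Trace R :=
  if h : ∃ z, u = z * letter R a then h.choose else 1

end TraceMonoid

end

/-!
# Pyramidal factorization of random traces

All the combinatorics rests on Levi's lemma for last letters (`levi_letter`): if `x c = y b` with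
`c ≠ b`, then `b` and `c` commute and `x = t b`, `y = t c`. It is obtained by letting the trace
monoid act on pairs made of a trace and its right quotient by `b`. It gives right cancellation and
the unique factorization `x = v w` with `max(v) ⊆ T` and `w` free of letters of `T`
(`mul_inj_of_maxLetters_subset`). Taking `T = {a}` and peeling off the occurrences of `a` one at a
time gives the factorization through `a`-pyramidal traces.

Give weight `p ^ |x|` to each trace; this weight is multiplicative along unique factorizations
(`weight_eq_mul`). The factorization for a general `T` yields
`∑_{x ∈ M_A, max(x) ⊆ T} p ^ |x| = G_A / G_{A \ T}`, where `G_A = ∑_{x ∈ M_A} p ^ |x|`. Peeling off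
the letter `a ∈ T`, the traces of `M_{A ∪ {a}}` with `max(x) ⊆ T` and `k` occurrences of `a` have
total weight `ρ ^ k` times the weight of the traces of `M_A` with `max(x) ⊆ T`, where
`ρ = p G_A / G_{A \ link a}` is the weight of the pyramidal traces (`weight_maxIn_inter_count`).
Summing over `k` and comparing with the recursion `μ_{A ∪ {a}} = μ_A - X μ_{A \ link a}`
(`mobiusVal_insert`) shows `G_A = 1 / μ_A(p)` by induction on `A` (`weight_sub`). The positivity
that makes this licit is elementary: `μ_S > 0` on `[0, p]` as `p` lies below the smallest root, and
it passes to all subsets by looking at the first zero (`mobiusVal_pos_of_subset`).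

The law of `K` is read off `weight_maxIn_inter_count`, with `ρ = r`. For the conditional laws, the
traces with `max(x) ⊆ T` and `k` occurrences of `a ∈ T` correspond bijectively to the tuples of `k`
pyramidal traces and a trace of `M_{S \ {a}}` with last letters in `T`
(`mem_maxIn_count_pyrU_iff`). The weight being multiplicative, the normalized weight becomes a
product measure (`map_pyrU_cond`), whose marginals are the stated laws.
-/

noncomputable section

namespace TraceMonoid

variable {S : Type*} {R : S → S → Prop} {a : S} {q : ENNReal}

theorem letter_mul_comm {a b : S} (h : ¬ R a b) :
    letter R a * letter R b = letter R b * letter R a :=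
  PresentedMonoid.mk_eq_mk_of_rel ⟨a, b, h, rfl, rfl⟩

theorem trace_induction {C : Trace R → Prop} (one : C 1)
    (mul_letter : ∀ x b, C x → C (x * letter R b)) (x : Trace R) : C x := by
  refine Submonoid.induction_of_closure_eq_top_right
    (PresentedMonoid.closure_range_of (CommRel R)) x one ?_
  rintro x _ ⟨b, rfl⟩ h
  exact mul_letter x b h

instance [Countable S] : Countable (Trace R) :=
  haveI : Countable (FreeMonoid S) := inferInstanceAs (Countable (List S))
  (PresentedMonoid.surjective_mk (rels := CommRel R)).countable

/-! ### Length and number of occurrences -/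

@[simp] theorem length_one : length (1 : Trace R) = 0 := by simp [length]

@[simp] theorem length_mul (x y : Trace R) : length (x * y) = length x + length y := by
  simp [length]

@[simp] theorem length_letter (b : S) : length (letter R b) = 1 := rfl

@[simp] theorem count_one (a : S) : count a (1 : Trace R) = 0 := by simp [count]

@[simp] theorem count_mul (a : S) (x y : Trace R) : count a (x * y) = count a x + count a y := by
  simp [count]

@[simp] theorem count_letter_self (a : S) : count a (letter R a) = 1 := by
  simp [count, countHom, letter]

theorem count_letter_of_ne {a b : S} (h : b ≠ a) : count a (letter R b) = 0 := by
  simp [count, countHom, letter, h]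

theorem mem_sub_iff {A : Set S} {x : Trace R} : x ∈ sub R A ↔ ∀ b, count b x ≠ 0 → b ∈ A := by
  constructor
  · intro hx
    refine Submonoid.closure_induction (motive := fun x _ => ∀ b, count b x ≠ 0 → b ∈ A)
      ?_ ?_ ?_ hx
    · rintro _ ⟨c, hc, rfl⟩ b hb
      by_cases h : c = b
      · exact h ▸ hc
      · exact absurd (count_letter_of_ne h) hb
    · simp
    · intro x y _ _ hx hy b hb
      rw [count_mul] at hb
      by_cases h : count b x = 0
      · exact hy b (by omega)
      · exact hx b h
  · refine trace_induction (C := fun x => (∀ b, count b x ≠ 0 → b ∈ A) → x ∈ sub R A) ?_ ?_ x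
    · exact fun _ => one_mem _
    · intro x b ih h
      refine mul_mem (ih fun c hc => h c ?_) (Submonoid.subset_closure ⟨b, h b ?_, rfl⟩)
      · rw [count_mul]; omega
      · simp

theorem mul_mem_sub_iff {A : Set S} {x y : Trace R} :
    x * y ∈ sub R A ↔ x ∈ sub R A ∧ y ∈ sub R A := by
  simp only [mem_sub_iff, count_mul]
  constructor
  · exact fun h => ⟨fun b hb => h b (by omega), fun b hb => h b (by omega)⟩
  · rintro ⟨h, h'⟩ b hb
    by_cases hx : count b x = 0
    · exact h' b (by omega)
    · exact h b hx

theorem letter_mem_sub_iff {A : Set S} {b : S} : letter R b ∈ sub R A ↔ b ∈ A := by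
  rw [mem_sub_iff]
  constructor
  · exact fun h => h b (by simp)
  · intro h c hc
    by_cases e : b = c
    · exact e ▸ h
    · exact absurd (count_letter_of_ne e) hc

theorem sub_mono {A B : Set S} (h : A ⊆ B) : sub R A ≤ sub R B :=
  Submonoid.closure_mono (Set.image_mono h)

theorem mem_sub_compl_singleton_iff {a : S} {x : Trace R} :
    x ∈ sub R {a}ᶜ ↔ count a x = 0 := by
  rw [mem_sub_iff]
  constructor
  · intro h
    by_contra h'
    exact h a h' rfl
  · rintro h b hb rfl
    exact hb h

theorem sub_univ (x : Trace R) : x ∈ sub R (Set.univ : Set S) :=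
  mem_sub_iff.2 fun _ _ => trivial

theorem eq_one_of_mem_sub_empty {x : Trace R} (h : x ∈ sub R (∅ : Set S)) : x = 1 := by
  simpa [sub] using h

/-! ### Quotient by a final letter -/

open Classical in
/-- One step of the computation of right quotients by `b`: if `o` is the right quotient of `x`
by `b` (`none` when there is none), the pair `(x, o)` is sent by the letter `c` to `x * c`
together with its right quotient by `b`. -/
def quotStep (R : S → S → Prop) (b c : S) (s : Trace R × Option (Trace R)) :
    Trace R × Option (Trace R) :=
  (s.1 * letter R c,
    if c = b then some s.1 else if R b c then none else s.2.map (· * letter R c))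

theorem quotStep_comm (hrefl : ∀ a, R a a) (hsymm : ∀ a b, R a b → R b a) (b : S) {c d : S}
    (h : ¬ R c d) (s : Trace R × Option (Trace R)) :
    quotStep R b d (quotStep R b c s) = quotStep R b c (quotStep R b d s) := by
  have hcd : c ≠ d := fun e => h (e ▸ hrefl c)
  have hm : ∀ x : Trace R, x * letter R c * letter R d = x * letter R d * letter R c := fun x => by
    rw [mul_assoc, letter_mul_comm h, mul_assoc]
  obtain ⟨x, o⟩ := s
  refine Prod.ext (hm x) ?_
  simp only [quotStep]
  by_cases hc : c = b
  · subst hc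
    simp [hcd.symm, h]
  by_cases hd : d = b
  · subst hd
    have hdc : ¬ R d c := fun e => h (hsymm _ _ e)
    simp [hcd, hdc]
  by_cases rc : R b c <;> by_cases rd : R b d <;> cases o <;> simp [hc, hd, rc, rd, hm]

/-- The action of traces on the right of pairs given by `quotStep`. -/
def quotHom (hrefl : ∀ a, R a a) (hsymm : ∀ a b, R a b → R b a) (b : S) :
    Trace R →* (Function.End (Trace R × Option (Trace R)))ᵐᵒᵖ :=
  PresentedMonoid.lift (M := (Function.End (Trace R × Option (Trace R)))ᵐᵒᵖ)
    (fun c => MulOpposite.op (quotStep R b c)) (by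
    rintro _ _ ⟨c, d, h, rfl, rfl⟩
    simp only [map_mul, FreeMonoid.lift_eval_of]
    exact congrArg _ (funext fun s => quotStep_comm hrefl hsymm b h s))

/-- The right quotient of `x` by the letter `b`, and `none` if `b` is not a last letter of `x`. -/
def quot (hrefl : ∀ a, R a a) (hsymm : ∀ a b, R a b → R b a) (b : S) (x : Trace R) :
    Option (Trace R) :=
  ((quotHom hrefl hsymm b x).unop (1, none)).2

section
variable (hrefl : ∀ a, R a a) (hsymm : ∀ a b, R a b → R b a)

theorem quotHom_mul_letter (b c : S) (x : Trace R) (s) :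
    (quotHom hrefl hsymm b (x * letter R c)).unop s =
      quotStep R b c ((quotHom hrefl hsymm b x).unop s) := by
  rw [map_mul]
  rfl

theorem quotHom_fst (b : S) (x : Trace R) : ((quotHom hrefl hsymm b x).unop (1, none)).1 = x := by
  induction x using trace_induction with
  | one => rw [map_one]; rfl
  | mul_letter x c ih => rw [quotHom_mul_letter, quotStep, ih]

theorem quot_mul_self (b : S) (x : Trace R) : quot hrefl hsymm b (x * letter R b) = some x := by
  rw [quot, quotHom_mul_letter, quotStep, quotHom_fst]
  simp

theorem quot_mul_of_ne {b c : S} (h : c ≠ b) (x : Trace R) [Decidable (R b c)] :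
    quot hrefl hsymm b (x * letter R c) =
      if R b c then none else (quot hrefl hsymm b x).map (· * letter R c) := by
  rw [quot, quotHom_mul_letter, quotStep, quotHom_fst]
  simp [h, quot]

theorem eq_mul_of_quot_eq_some (b : S) (x : Trace R) :
    ∀ t, quot hrefl hsymm b x = some t → x = t * letter R b := by
  classical
  induction x using trace_induction with
  | one => intro t h; rw [quot, map_one] at h; cases h
  | mul_letter x c ih =>
    intro t h
    by_cases e : c = b
    · subst e
      rw [quot_mul_self] at h
      rw [Option.some.inj h]
    · rw [quot_mul_of_ne hrefl hsymm e] at h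
      split_ifs at h with hR
      obtain ⟨t', ht', rfl⟩ := Option.map_eq_some_iff.1 h
      rw [ih t' ht', mul_assoc, mul_assoc, letter_mul_comm hR]

include hrefl hsymm in
theorem mul_letter_cancel {b : S} {x y : Trace R} (h : x * letter R b = y * letter R b) :
    x = y := by
  have := quot_mul_self hrefl hsymm b x
  rw [h, quot_mul_self] at this
  exact (Option.some.inj this).symm

/-- Levi's lemma for two distinct last letters of the same trace. -/
theorem levi_letter (hrefl : ∀ a, R a a) (hsymm : ∀ a b, R a b → R b a) {b c : S} (hne : c ≠ b)
    {x y : Trace R} (h : x * letter R c = y * letter R b) :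
    ¬ R b c ∧ ∃ t, x = t * letter R b ∧ y = t * letter R c := by
  classical
  have h1 := quot_mul_self hrefl hsymm b y
  rw [← h, quot_mul_of_ne hrefl hsymm hne] at h1
  split_ifs at h1 with hR
  obtain ⟨t, ht, rfl⟩ := Option.map_eq_some_iff.1 h1
  exact ⟨hR, t, eq_mul_of_quot_eq_some hrefl hsymm b x t ht, rfl⟩
end

/-! ### Last letters -/

@[simp] theorem maxLetters_one : maxLetters (1 : Trace R) = ∅ := by
  refine Set.eq_empty_of_forall_notMem ?_
  rintro b ⟨y, h⟩
  have := congrArg length h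
  simp at this

theorem maxLetters_subset_mul (x y : Trace R) : maxLetters y ⊆ maxLetters (x * y) := by
  rintro b ⟨z, rfl⟩
  exact ⟨x * z, (mul_assoc _ _ _).symm⟩

theorem mem_maxLetters_mul_letter (x : Trace R) (b : S) : b ∈ maxLetters (x * letter R b) :=
  ⟨x, rfl⟩

section
variable (hrefl : ∀ a, R a a) (hsymm : ∀ a b, R a b → R b a)
include hrefl hsymm

theorem maxLetters_mul_subset (x y : Trace R) :
    maxLetters (x * y) ⊆ maxLetters x ∪ maxLetters y := by
  induction y using trace_induction with
  | one => simp
  | mul_letter y c ih =>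
    rintro b ⟨z, h⟩
    by_cases e : c = b
    · exact Or.inr ⟨y, by rw [e]⟩
    rw [← mul_assoc] at h
    obtain ⟨hR, t, ht, -⟩ := levi_letter hrefl hsymm e h
    rcases ih ⟨t, ht⟩ with hb | ⟨s, hs⟩
    · exact Or.inl hb
    · refine Or.inr ⟨s * letter R c, ?_⟩
      rw [hs, mul_assoc, mul_assoc, letter_mul_comm hR]

theorem maxLetters_mul_letter_subset_singleton_iff {a : S} {y : Trace R} :
    maxLetters (y * letter R a) ⊆ {a} ↔ maxLetters y ⊆ link R a := by
  constructor
  · rintro h b ⟨z, rfl⟩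
    by_contra hb
    have : b ∈ maxLetters (z * letter R b * letter R a) := by
      refine ⟨z * letter R a, ?_⟩
      rw [mul_assoc, mul_assoc, letter_mul_comm (a := a) (b := b) hb]
    exact hb (h this ▸ hrefl a)
  · rintro h b ⟨z, hz⟩
    by_contra hb
    obtain ⟨hR, t, ht, -⟩ := levi_letter hrefl hsymm (Ne.symm hb) hz
    exact hR (hsymm _ _ (h ⟨t, ht⟩))

omit hrefl hsymm in
/-- Letters outside `T` are stripped from the end of `x` as long as possible. -/
theorem exists_eq_mul_maxLetters_subset (T : Set S) (x : Trace R) :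
    ∃ v w, x = v * w ∧ maxLetters v ⊆ T ∧ w ∈ sub R Tᶜ := by
  induction hn : length x generalizing x with
  | zero =>
    refine ⟨x, 1, (mul_one x).symm, ?_, one_mem _⟩
    rintro b ⟨y, rfl⟩
    simp at hn
  | succ n ih =>
    by_cases h : maxLetters x ⊆ T
    · exact ⟨x, 1, (mul_one x).symm, h, one_mem _⟩
    obtain ⟨b, ⟨y, rfl⟩, hb⟩ := Set.not_subset.1 h
    obtain ⟨v, w, rfl, hv, hw⟩ := ih y (by simpa using hn)
    exact ⟨v, w * letter R b, mul_assoc _ _ _, hv, mul_mem hw (letter_mem_sub_iff.2 hb)⟩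

/-- Uniqueness in the factorization `x = v * w` with `max(v) ⊆ T` and `w` free of letters of `T`:
a last letter of `w`, not being in `T`, can only be a last letter of the other second factor. -/
theorem mul_inj_of_maxLetters_subset {T : Set S} {v w v' w' : Trace R} (h : v * w = v' * w')
    (hv : maxLetters v ⊆ T) (hw : w ∈ sub R Tᶜ) (hv' : maxLetters v' ⊆ T) (hw' : w' ∈ sub R Tᶜ) :
    v = v' ∧ w = w' := by
  induction w using trace_induction generalizing w' with
  | one =>
    induction w' using trace_induction with
    | one => simpa using h
    | mul_letter w' b _ =>
      rw [mul_one] at h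
      exact absurd (hv (h ▸ maxLetters_subset_mul v' _ (mem_maxLetters_mul_letter w' b)))
        (letter_mem_sub_iff.1 (mul_mem_sub_iff.1 hw').2)
  | mul_letter w b ih =>
    have hb : b ∉ T := letter_mem_sub_iff.1 (mul_mem_sub_iff.1 hw).2
    have hmem : b ∈ maxLetters (v' * w') :=
      h ▸ maxLetters_subset_mul v _ (mem_maxLetters_mul_letter w b)
    rcases maxLetters_mul_subset hrefl hsymm v' w' hmem with hb' | ⟨u, rfl⟩
    · exact absurd (hv' hb') hb
    rw [← mul_assoc, ← mul_assoc] at h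
    obtain ⟨h1, h2⟩ := ih (mul_letter_cancel hrefl hsymm h) (mul_mem_sub_iff.1 hw).1
      (mul_mem_sub_iff.1 hw').1
    exact ⟨h1, by rw [h2]⟩

end

/-! ### The weight of a set of traces -/

/-- The traces of `M_A` whose last letters all belong to `T`. -/
def maxIn (R : S → S → Prop) (A T : Set S) : Set (Trace R) :=
  {x | x ∈ sub R A ∧ maxLetters x ⊆ T}

/-- The measure on the set of traces that gives the mass `q ^ |x|` to each trace `x`. -/
def weight (R : S → S → Prop) (q : ENNReal) : Measure (Trace R) :=
  Measure.sum fun x => q ^ length x • Measure.dirac x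

theorem weight_apply (C : Set (Trace R)) : weight R q C = ∑' x : C, q ^ length (x : Trace R) := by
  rw [weight, Measure.sum_apply _ (MeasurableSet.of_discrete), tsum_subtype C fun x => q ^ length x]
  refine tsum_congr fun x => ?_
  by_cases h : x ∈ C <;> simp [h]

@[simp] theorem weight_singleton (x : Trace R) : weight R q {x} = q ^ length x := by
  rw [weight_apply, tsum_singleton x fun x => q ^ length x]

/-- The weight is multiplicative along unique factorizations. -/
theorem weight_eq_mul {A B C : Set (Trace R)}
    (h : Set.BijOn (fun z : Trace R × Trace R => z.1 * z.2) (A ×ˢ B) C) :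
    weight R q C = weight R q A * weight R q B := by
  rw [weight_apply, weight_apply, weight_apply,
    ← ENNReal.tsum_mul_right]
  simp_rw [← ENNReal.tsum_mul_left]
  rw [← ENNReal.tsum_prod (f := fun (x : A) (y : B) =>
      q ^ length (x : Trace R) * q ^ length (y : Trace R)),
    ← ((Equiv.Set.prod A B).symm.trans (Set.BijOn.equiv _ h)).tsum_eq]
  refine tsum_congr fun z => ?_
  rw [← pow_add, ← length_mul]
  rfl

section
variable (hrefl : ∀ a, R a a) (hsymm : ∀ a b, R a b → R b a)
include hrefl hsymm

/-- The factorization `x = v * w` with `max(v) ⊆ T` and `w ∈ M_{A \ T}`, in terms of weights. -/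
theorem weight_maxIn_mul_weight_sub (A T : Set S) :
    weight R q (maxIn R A T) * weight R q (sub R (A \ T)) = weight R q (sub R A) := by
  refine (weight_eq_mul ⟨?_, ?_, ?_⟩).symm
  · rintro ⟨v, w⟩ ⟨hv, hw⟩
    exact mul_mem hv.1 (sub_mono Set.sdiff_subset hw)
  · rintro ⟨v, w⟩ ⟨hv, hw⟩ ⟨v', w'⟩ ⟨hv', hw'⟩ h
    have hsub : sub R (A \ T) ≤ sub R Tᶜ := sub_mono fun _ hx => hx.2
    exact Prod.ext_iff.2
      (mul_inj_of_maxLetters_subset hrefl hsymm h hv.2 (hsub hw) hv'.2 (hsub hw'))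
  · intro x hx
    obtain ⟨v, w, rfl, hv, hw⟩ := exists_eq_mul_maxLetters_subset T x
    have := mul_mem_sub_iff.1 (SetLike.mem_coe.1 hx)
    exact ⟨(v, w), ⟨⟨this.1, hv⟩, mem_sub_iff.2 fun b hb =>
      ⟨mem_sub_iff.1 this.2 b hb, mem_sub_iff.1 hw b hb⟩⟩, rfl⟩

/-- Splitting off the maximal suffix without `a`: what is left ends with an `a`, or is empty. -/
theorem bijOn_maxIn_insert {A T : Set S} {a : S} (ha : a ∉ A) (haT : a ∈ T) (k : ℕ) :
    Set.BijOn (fun z : Trace R × Trace R => z.1 * z.2)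
      ((maxIn R (insert a A) {a} ∩ {x | count a x = k}) ×ˢ maxIn R A T)
      (maxIn R (insert a A) T ∩ {x | count a x = k}) := by
  have hsub : sub R A ≤ sub R {a}ᶜ := sub_mono (Set.subset_compl_singleton_iff.2 ha)
  refine ⟨?_, ?_, ?_⟩
  · rintro ⟨v, w⟩ ⟨⟨hv, hk⟩, hw⟩
    refine ⟨⟨mul_mem hv.1 (sub_mono (Set.subset_insert _ _) hw.1), ?_⟩, ?_⟩
    · exact (maxLetters_mul_subset hrefl hsymm v w).trans (Set.union_subset
        (hv.2.trans (Set.singleton_subset_iff.2 haT)) hw.2)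
    · have := mem_sub_compl_singleton_iff.1 (hsub hw.1)
      simp only [Set.mem_ofPred_eq] at hk ⊢
      simp [hk, this]
  · rintro ⟨v, w⟩ ⟨hv, hw⟩ ⟨v', w'⟩ ⟨hv', hw'⟩ h
    exact Prod.ext_iff.2
      (mul_inj_of_maxLetters_subset hrefl hsymm h hv.1.2 (hsub hw.1) hv'.1.2 (hsub hw'.1))
  · rintro x ⟨⟨hx, hT⟩, hk⟩
    obtain ⟨v, w, rfl, hv, hw⟩ := exists_eq_mul_maxLetters_subset {a} x
    have := mul_mem_sub_iff.1 hx
    refine ⟨(v, w), ⟨⟨⟨this.1, hv⟩, ?_⟩, ?_, (maxLetters_subset_mul v w).trans hT⟩, rfl⟩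
    · simpa [mem_sub_compl_singleton_iff.1 hw] using hk
    · refine mem_sub_iff.2 fun b hb => ?_
      exact (mem_sub_iff.1 this.2 b hb).resolve_left (mem_sub_iff.1 hw b hb)

theorem bijOn_mul_letter {A : Set S} {a : S} (k : ℕ) :
    Set.BijOn (fun z : Trace R × Trace R => z.1 * z.2)
      ((maxIn R (insert a A) (link R a) ∩ {x | count a x = k}) ×ˢ {letter R a})
      (maxIn R (insert a A) {a} ∩ {x | count a x = k + 1}) := by
  refine ⟨?_, ?_, ?_⟩
  · rintro ⟨v, w⟩ ⟨⟨hv, hk⟩, rfl⟩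
    refine ⟨⟨mul_mem hv.1 (letter_mem_sub_iff.2 (Set.mem_insert _ _)),
      (maxLetters_mul_letter_subset_singleton_iff hrefl hsymm).2 hv.2⟩, ?_⟩
    simp only [Set.mem_ofPred_eq] at hk ⊢
    simp [hk]
  · rintro ⟨v, w⟩ ⟨_, rfl⟩ ⟨v', w'⟩ ⟨_, rfl⟩ h
    exact Prod.ext (mul_letter_cancel hrefl hsymm h) rfl
  · rintro x ⟨⟨hx, hT⟩, hk⟩
    induction x using trace_induction with
    | one => simp at hk
    | mul_letter x b _ =>
      obtain rfl : b = a := hT (mem_maxLetters_mul_letter x b)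
      refine ⟨(x, letter R b), ⟨⟨⟨(mul_mem_sub_iff.1 hx).1,
        (maxLetters_mul_letter_subset_singleton_iff hrefl hsymm).1 hT⟩, ?_⟩, rfl⟩, rfl⟩
      simpa using hk

omit hrefl hsymm in
theorem maxIn_singleton_inter_count_zero (A : Set S) (a : S) :
    maxIn R A {a} ∩ {x | count a x = 0} = {1} := by
  refine Set.eq_singleton_iff_unique_mem.2 ⟨⟨⟨one_mem _, by simp⟩, by simp⟩, ?_⟩
  rintro x ⟨⟨-, hx⟩, h0⟩
  induction x using trace_induction with
  | one => rfl
  | mul_letter x b _ =>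
    obtain rfl : b = a := hx (mem_maxLetters_mul_letter x b)
    simp at h0

/-- The total weight of the traces with `k` occurrences of `a`: each occurrence contributes the
weight of the `a`-pyramidal traces. -/
theorem weight_maxIn_inter_count {A T : Set S} {a : S} (ha : a ∉ A) (haT : a ∈ T) (k : ℕ) :
    weight R q (maxIn R (insert a A) T ∩ {x | count a x = k}) =
      (weight R q (maxIn R A (link R a)) * q) ^ k * weight R q (maxIn R A T) := by
  rw [weight_eq_mul (bijOn_maxIn_insert hrefl hsymm ha haT k)]
  congr 1
  induction k with
  | zero => rw [maxIn_singleton_inter_count_zero]; simp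
  | succ k ih =>
    rw [weight_eq_mul (bijOn_mul_letter hrefl hsymm k),
      weight_eq_mul (bijOn_maxIn_insert hrefl hsymm ha (show a ∈ link R a from hrefl a) k), ih, weight_singleton,
      length_letter, pow_one, mul_assoc, pow_succ]

theorem weight_maxIn_insert {A T : Set S} {a : S} (ha : a ∉ A) (haT : a ∈ T) :
    weight R q (maxIn R (insert a A) T) =
      (1 - weight R q (maxIn R A (link R a)) * q)⁻¹ * weight R q (maxIn R A T) := by
  have hU : maxIn R (insert a A) T = ⋃ k, maxIn R (insert a A) T ∩ {x | count a x = k} := by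
    ext x
    simp
  rw [hU, measure_iUnion _ fun _ => MeasurableSet.of_discrete]
  · simp_rw [weight_maxIn_inter_count hrefl hsymm ha haT]
    rw [ENNReal.tsum_mul_right, ENNReal.tsum_geometric]
  · intro i j hij
    refine Set.disjoint_left.2 ?_
    rintro x ⟨-, hi⟩ ⟨-, hj⟩
    exact hij (hi.symm.trans hj)

end

theorem maxIn_univ (A : Set S) : maxIn R A Set.univ = sub R A := by
  ext x
  simp [maxIn]

/-! ### The Möbius polynomial -/

section
variable [Fintype S]

open Classical in
theorem mobiusVal_eq_sum (A : Set S) (p : ℝ) :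
    mobiusVal R A p = ∑ γ ∈ (Finset.univ : Finset (Finset S)).filter
      (fun γ : Finset S => (γ : Set S) ⊆ A ∧ (γ : Set S).Pairwise (fun a b => ¬ R a b)),
        (-p) ^ γ.card := by
  rw [mobiusVal, mobius, map_sum]
  refine Finset.sum_congr rfl fun γ _ => ?_
  rw [neg_pow p]
  simp

theorem continuous_mobiusVal (A : Set S) : Continuous (mobiusVal R A) :=
  (mobius R A).continuous_aeval

@[simp] theorem mobiusVal_zero (A : Set S) : mobiusVal R A 0 = 1 := by
  classical
  rw [mobiusVal_eq_sum, Finset.sum_eq_single ∅]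
  · simp
  · intro γ _ hγ
    simp [hγ]
  · simp

@[simp] theorem mobiusVal_empty (p : ℝ) : mobiusVal R (∅ : Set S) p = 1 := by
  classical
  rw [mobiusVal_eq_sum, Finset.sum_eq_single ∅]
  · simp
  · intro γ h hγ
    simp only [Finset.mem_filter, Set.subset_empty_iff, Finset.coe_eq_empty] at h
    exact absurd h.2.1 hγ
  · simp

/-- The cliques of `insert a A` are those of `A`, and the `insert a γ` with `γ` a clique of
letters of `A` that all commute with `a`. -/
theorem mobiusVal_insert (hsymm : ∀ a b, R a b → R b a) {A : Set S} {a : S} (ha : a ∉ A) (p : ℝ) :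
    mobiusVal R (insert a A) p = mobiusVal R A p - p * mobiusVal R (A \ link R a) p := by
  classical
  have hs : Std.Symm fun b c => ¬ R b c := ⟨fun b c h h' => h (hsymm _ _ h')⟩
  have hA : ∀ {B : Set S} {γ : Finset S}, B ⊆ A → (γ : Set S) ⊆ B → a ∉ γ :=
    fun h h' h'' => ha (h (h' h''))
  simp only [mobiusVal_eq_sum]
  rw [← Finset.sum_filter_not_add_sum_filter _ (fun γ : Finset S => a ∈ γ), sub_eq_add_neg,
    ← neg_mul, Finset.mul_sum]
  congr 1
  · refine Finset.sum_congr ?_ fun _ _ => rfl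
    ext γ
    simp only [Finset.mem_filter, Finset.mem_univ, true_and]
    constructor
    · rintro ⟨⟨h1, h2⟩, h3⟩
      exact ⟨(Set.subset_insert_iff_of_notMem h3).1 h1, h2⟩
    · rintro ⟨h1, h2⟩
      exact ⟨⟨h1.trans (Set.subset_insert _ _), h2⟩, hA subset_rfl h1⟩
  · symm
    refine Finset.sum_bij' (fun γ _ => insert a γ) (fun γ _ => γ.erase a) ?_ ?_ ?_ ?_ ?_
    · intro γ h
      simp only [Finset.mem_filter, Finset.mem_univ, true_and] at h ⊢
      refine ⟨⟨?_, ?_⟩, Finset.mem_insert_self _ _⟩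
      · rw [Finset.coe_insert]
        exact Set.insert_subset_insert (h.1.trans Set.sdiff_subset)
      · rw [Finset.coe_insert]
        exact h.2.insert fun b hb _ =>
          ⟨fun hR => (h.1 hb).2 hR, fun hR => (h.1 hb).2 (hsymm _ _ hR)⟩
    · intro γ h
      simp only [Finset.mem_filter, Finset.mem_univ, true_and] at h ⊢
      refine ⟨fun b hb => ?_, h.1.2.mono (by simp)⟩
      rw [Finset.coe_erase] at hb
      exact ⟨(h.1.1 hb.1).resolve_left hb.2, h.1.2 h.2 hb.1 (Ne.symm hb.2)⟩
    · intro γ h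
      simp only [Finset.mem_filter, Finset.mem_univ, true_and] at h
      exact Finset.erase_insert (hA Set.sdiff_subset h.1)
    · intro γ h
      simp only [Finset.mem_filter, Finset.mem_univ, true_and] at h
      exact Finset.insert_erase h.2
    · intro γ h
      simp only [Finset.mem_filter, Finset.mem_univ, true_and] at h
      rw [Finset.card_insert_of_notMem (hA Set.sdiff_subset h.1), pow_succ']

/-- If `μ_A` is positive on `[0, p]`, so is `μ_B` for `B ⊆ A`. At the first zero `q` of
`μ_{A \ {a}}`, the recursion of `mobiusVal_insert` would give
`μ_A(q) = - q μ_{A \ ({a} ∪ link a)}(q) ≤ 0`. -/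
theorem mobiusVal_pos_of_subset (hsymm : ∀ a b, R a b → R b a) (A : Set S) :
    ∀ p : ℝ, (∀ t ∈ Set.Icc 0 p, 0 < mobiusVal R A t) →
      ∀ B ⊆ A, ∀ t ∈ Set.Icc 0 p, 0 < mobiusVal R B t := by
  induction A using WellFoundedLT.induction with
  | ind A ih =>
  intro p hp B hBA
  by_cases hAB : A ⊆ B
  · rwa [Set.Subset.antisymm hBA hAB]
  obtain ⟨a, haA, haB⟩ := Set.not_subset.1 hAB
  have hlt : A \ {a} < A := Set.sdiff_singleton_ssubset.2 haA
  refine ih _ hlt p ?_ B (Set.subset_sdiff_singleton hBA haB)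
  by_contra! hneg
  -- The first point `q` where `μ_{A \ {a}}` is not positive.
  let Z := Set.Icc 0 p ∩ {t | mobiusVal R (A \ {a}) t ≤ 0}
  have hZc : IsCompact Z :=
    isCompact_Icc.inter_right (isClosed_le (continuous_mobiusVal _) continuous_const)
  obtain ⟨q, ⟨hq, hq0⟩, hmin⟩ := hZc.exists_isLeast hneg
  rw [Set.mem_ofPred_eq] at hq0
  have hqpos : 0 < q := by
    refine hq.1.lt_of_ne ?_
    rintro rfl
    rw [mobiusVal_zero] at hq0
    linarith
  have hlink : 0 ≤ mobiusVal R ((A \ {a}) \ link R a) q := by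
    refine ge_of_tendsto (x := nhdsWithin q (Set.Iio q))
      ((continuous_mobiusVal _).continuousAt.tendsto.mono_left nhdsWithin_le_nhds) ?_
    filter_upwards [Ioo_mem_nhdsLT hqpos] with t ht
    refine (ih _ hlt t (fun s hs => ?_) _ Set.sdiff_subset t ⟨ht.1.le, le_rfl⟩).le
    by_contra! hs'
    have := hmin ⟨⟨hs.1, hs.2.trans (ht.2.le.trans hq.2)⟩, hs'⟩
    linarith [hs.2, ht.2]
  have hrec := mobiusVal_insert hsymm (A := A \ {a}) (a := a) (by simp) q
  rw [Set.insert_sdiff_singleton, Set.insert_eq_of_mem haA] at hrec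
  have := hp q hq
  nlinarith [mul_nonneg hqpos.le hlink]

/-- A real polynomial equal to `1` at `0` stays positive below the smallest modulus of its roots. -/
theorem mobiusVal_univ_pos_of_lt_minRoot {p : ℝ} (hp : p < minRoot R) :
    ∀ t ∈ Set.Icc 0 p, 0 < mobiusVal R (Set.univ : Set S) t := by
  intro t ht
  by_contra! hneg
  obtain ⟨s, hs, hs0⟩ := intermediate_value_Icc' ht.1
    (continuous_mobiusVal (R := R) Set.univ).continuousOn
    (show (0 : ℝ) ∈ Set.Icc _ _ from ⟨hneg, by simp⟩)
  have : minRoot R ≤ s := by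
    refine csInf_le ⟨0, ?_⟩ ⟨(s : ℂ), ?_, ?_⟩
    · rintro _ ⟨z, -, rfl⟩
      exact norm_nonneg z
    · have h := Polynomial.aeval_algebraMap_apply ℂ s (mobius R (Set.univ : Set S))
      rw [Complex.coe_algebraMap] at h
      rw [h]
      simpa [mobiusVal] using hs0
    · rw [Complex.norm_real, Real.norm_of_nonneg hs.1]
  linarith [hs.2, ht.2]

/-! ### The generating series of a trace monoid -/

section
variable (hrefl : ∀ a, R a a) (hsymm : ∀ a b, R a b → R b a)
include hrefl hsymm

theorem weight_maxIn_of_weight_sub {A T : Set S} {p : ℝ}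
    (hAT : 0 < mobiusVal R (A \ T) p)
    (h : weight R (ENNReal.ofReal p) (sub R A) = ENNReal.ofReal (mobiusVal R A p)⁻¹)
    (h' : weight R (ENNReal.ofReal p) (sub R (A \ T)) =
      ENNReal.ofReal (mobiusVal R (A \ T) p)⁻¹) :
    weight R (ENNReal.ofReal p) (maxIn R A T) =
      ENNReal.ofReal (mobiusVal R (A \ T) p / mobiusVal R A p) := by
  have key := weight_maxIn_mul_weight_sub (q := ENNReal.ofReal p) hrefl hsymm A T
  rw [h, h', ENNReal.ofReal_inv_of_pos hAT, ← div_eq_mul_inv] at key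
  rw [eq_comm, ENNReal.eq_div_iff (by simpa using hAT) ENNReal.ofReal_ne_top] at key
  rw [← key, ← ENNReal.ofReal_mul hAT.le, div_eq_mul_inv]

/-- The Cartier–Foata formula `∑_{x ∈ M_A} p ^ |x| = 1 / μ_A(p)`. -/
theorem weight_sub (A : Set S) : ∀ p : ℝ, 0 ≤ p → (∀ t ∈ Set.Icc 0 p, 0 < mobiusVal R A t) →
    weight R (ENNReal.ofReal p) (sub R A) = ENNReal.ofReal (mobiusVal R A p)⁻¹ := by
  induction A using WellFoundedLT.induction with
  | ind A ih =>
  intro p hp0 hp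
  have hpp : p ∈ Set.Icc 0 p := ⟨hp0, le_rfl⟩
  rcases A.eq_empty_or_nonempty with rfl | ⟨a, ha⟩
  · have : (sub R (∅ : Set S) : Set (Trace R)) = {1} :=
      Set.eq_singleton_iff_unique_mem.2 ⟨one_mem _, fun x hx => eq_one_of_mem_sub_empty hx⟩
    rw [this]
    simp
  have hlt : A \ {a} < A := Set.sdiff_singleton_ssubset.2 ha
  have hpos := mobiusVal_pos_of_subset hsymm A p hp
  have h1 := hpos _ hlt.le p hpp
  have hle : (A \ {a}) \ link R a ≤ A \ {a} := Set.sdiff_subset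
  have h2 := hpos _ (hle.trans hlt.le) p hpp
  have hG := ih _ hlt p hp0 (hpos _ hlt.le)
  have hG' := ih _ (hle.trans_lt hlt) p hp0 (hpos _ (hle.trans hlt.le))
  have hH := weight_maxIn_of_weight_sub hrefl hsymm h2 hG hG'
  have hrec := mobiusVal_insert hsymm (A := A \ {a}) (a := a) (by simp) p
  -- With `T` the whole alphabet, this is a geometric series for `G_A` in terms of `G_{A \ {a}}`.
  have hfac := weight_maxIn_insert (q := ENNReal.ofReal p) hrefl hsymm (A := A \ {a}) (a := a)
    (by simp) (Set.mem_univ a)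
  rw [Set.insert_sdiff_singleton, Set.insert_eq_of_mem ha] at hrec hfac
  rw [maxIn_univ, maxIn_univ, hG, hH, ← ENNReal.ofReal_mul (by positivity), ← ENNReal.ofReal_one,
    ← ENNReal.ofReal_sub _ (by positivity)] at hfac
  have hA := hp p hpp
  have e : 1 - mobiusVal R ((A \ {a}) \ link R a) p / mobiusVal R (A \ {a}) p * p =
      mobiusVal R A p / mobiusVal R (A \ {a}) p := by
    rw [hrec]
    field_simp
  rw [hfac, e, ← ENNReal.ofReal_inv_of_pos (by positivity), ← ENNReal.ofReal_mul (by positivity)]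
  congr 1
  field_simp

theorem weight_maxIn {A T : Set S} {p : ℝ} (hp0 : 0 ≤ p)
    (hp : ∀ t ∈ Set.Icc 0 p, 0 < mobiusVal R A t) :
    weight R (ENNReal.ofReal p) (maxIn R A T) =
      ENNReal.ofReal (mobiusVal R (A \ T) p / mobiusVal R A p) := by
  have hpos := mobiusVal_pos_of_subset hsymm A p hp _ (Set.sdiff_subset (t := T))
  exact weight_maxIn_of_weight_sub hrefl hsymm (hpos p ⟨hp0, le_rfl⟩)
    (weight_sub hrefl hsymm A p hp0 hp) (weight_sub hrefl hsymm _ p hp0 hpos)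

end
end

/-! ### The factorization through pyramidal traces -/

theorem count_eq_one_of_mem_Pyr {u : Trace R} (h : u ∈ Pyr R a) : count a u = 1 := by
  obtain ⟨z, hz, -, rfl⟩ := h
  simp [mem_sub_compl_singleton_iff.1 hz]

theorem count_prod_of_forall_mem_Pyr {l : List (Trace R)} (h : ∀ u ∈ l, u ∈ Pyr R a) :
    count a l.prod = l.length := by
  induction l with
  | nil => simp
  | cons u l ih =>
    rw [List.forall_mem_cons] at h
    simp [count_eq_one_of_mem_Pyr h.1, ih h.2, add_comm]

theorem Pyr_eq_image : Pyr R a = (· * letter R a) '' maxIn R {a}ᶜ (link R a) := by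
  ext u
  constructor
  · rintro ⟨z, hz, hm, rfl⟩
    exact ⟨z, ⟨hz, hm⟩, rfl⟩
  · rintro ⟨z, ⟨hz, hm⟩, rfl⟩
    exact ⟨z, hz, hm, rfl⟩

section
variable (hrefl : ∀ a, R a a) (hsymm : ∀ a b, R a b → R b a)
include hrefl hsymm

theorem maxLetters_prod_subset {l : List (Trace R)} (h : ∀ u ∈ l, u ∈ Pyr R a) :
    maxLetters l.prod ⊆ {a} := by
  induction l with
  | nil => simp
  | cons u l ih =>
    rw [List.forall_mem_cons] at h
    obtain ⟨⟨z, hz, hm, rfl⟩, hl⟩ := h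
    rw [List.prod_cons]
    exact (maxLetters_mul_subset hrefl hsymm _ _).trans (Set.union_subset
      ((maxLetters_mul_letter_subset_singleton_iff hrefl hsymm).2 hm) (ih hl))

theorem exists_isPyrFact (x : Trace R) : ∃ f, IsPyrFact a x f := by
  induction hn : length x using Nat.strong_induction_on generalizing x with
  | h n ih =>
  obtain ⟨v, w, rfl, hv, hw⟩ := exists_eq_mul_maxLetters_subset {a} x
  induction v using trace_induction with
  | one => exact ⟨([], w), by simp, hw, by simp⟩
  | mul_letter v b _ =>
    obtain rfl : b = a := hv (mem_maxLetters_mul_letter v b)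
    obtain ⟨⟨l, z⟩, hl, hz, rfl⟩ := ih (length v) (by simp at hn; omega) v rfl
    refine ⟨(l ++ [z * letter R b], w), ?_, hw, by simp [mul_assoc]⟩
    simp only [List.mem_append, List.mem_singleton]
    rintro u (hu | rfl)
    · exact hl u hu
    · exact ⟨z, hz, (maxLetters_subset_mul _ _).trans
        ((maxLetters_mul_letter_subset_singleton_iff hrefl hsymm).1 hv), rfl⟩

/-- Two products of pyramidal traces are compared from the end: after cancelling the last `a`, the
last pyramid is the maximal suffix without `a`. -/
theorem prod_inj_of_forall_mem_Pyr {l l' : List (Trace R)} (h : ∀ u ∈ l, u ∈ Pyr R a)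
    (h' : ∀ u ∈ l', u ∈ Pyr R a) (e : l.prod = l'.prod) : l = l' := by
  have hlen := congrArg (count a) e
  rw [count_prod_of_forall_mem_Pyr h, count_prod_of_forall_mem_Pyr h'] at hlen
  induction l using List.reverseRecOn generalizing l' with
  | nil => exact (List.length_eq_zero_iff.1 hlen.symm).symm
  | append_singleton l u ih =>
    induction l' using List.reverseRecOn with
    | nil => simp at hlen
    | append_singleton l' u' _ =>
      simp only [List.mem_append, List.mem_singleton] at h h'
      have hl : ∀ u ∈ l, u ∈ Pyr R a := fun v hv => h v (Or.inl hv)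
      have hl' : ∀ u ∈ l', u ∈ Pyr R a := fun v hv => h' v (Or.inl hv)
      obtain ⟨z, hz, -, rfl⟩ := h u (Or.inr rfl)
      obtain ⟨z', hz', -, rfl⟩ := h' u' (Or.inr rfl)
      simp only [List.prod_append, List.prod_singleton, ← mul_assoc] at e
      obtain ⟨e1, e2⟩ := mul_inj_of_maxLetters_subset hrefl hsymm
        (mul_letter_cancel hrefl hsymm e) (maxLetters_prod_subset hrefl hsymm hl) hz
        (maxLetters_prod_subset hrefl hsymm hl') hz'
      rw [ih hl hl' e1 (by simpa using hlen), e2]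

theorem isPyrFact_unique {x : Trace R} {f g : List (Trace R) × Trace R} (hf : IsPyrFact a x f)
    (hg : IsPyrFact a x g) : f = g := by
  obtain ⟨hf1, hf2, hf3⟩ := hf
  obtain ⟨hg1, hg2, hg3⟩ := hg
  obtain ⟨e1, e2⟩ := mul_inj_of_maxLetters_subset hrefl hsymm (hf3.symm.trans hg3)
    (maxLetters_prod_subset hrefl hsymm hf1) hf2 (maxLetters_prod_subset hrefl hsymm hg1) hg2
  exact Prod.ext (prod_inj_of_forall_mem_Pyr hrefl hsymm hf1 hg1 e1) e2

theorem isPyrFact_pyrFact (x : Trace R) : IsPyrFact a x (pyrFact a x) := by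
  have h := exists_isPyrFact (a := a) hrefl hsymm x
  rw [pyrFact, dif_pos h]
  exact h.choose_spec

theorem pyrK_eq_count (x : Trace R) : pyrK a x = count a x := by
  obtain ⟨h1, h2, h3⟩ := isPyrFact_pyrFact (a := a) hrefl hsymm x
  conv_rhs => rw [h3]
  rw [count_mul, count_prod_of_forall_mem_Pyr h1, mem_sub_compl_singleton_iff.1 h2]
  rfl

theorem removeLast_mul_letter (z : Trace R) : removeLast a (z * letter R a) = z := by
  have h : ∃ y, z * letter R a = y * letter R a := ⟨z, rfl⟩
  rw [removeLast, dif_pos h]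
  exact (mul_letter_cancel hrefl hsymm h.choose_spec).symm

/-- For `a ∈ T`, the condition `max(x) ⊆ T` only bears on the last factor of `x`. -/
theorem maxLetters_subset_iff {T : Set S} (haT : a ∈ T) {x : Trace R}
    {f : List (Trace R) × Trace R} (hf : IsPyrFact a x f) :
    maxLetters x ⊆ T ↔ maxLetters f.2 ⊆ T := by
  obtain ⟨h1, -, rfl⟩ := hf
  refine ⟨(maxLetters_subset_mul _ _).trans, fun h => ?_⟩
  exact (maxLetters_mul_subset hrefl hsymm _ _).trans (Set.union_subset
    ((maxLetters_prod_subset hrefl hsymm h1).trans (Set.singleton_subset_iff.2 haT)) h)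

end

/-- The set of values of the factor `U_i` of the traces `x` with `k` occurrences of `a` and
`max(x) ⊆ T`. -/
def factorSet (R : S → S → Prop) (a : S) (T : Set S) (k i : ℕ) : Set (Trace R) :=
  if i < k then Pyr R a else maxIn R {a}ᶜ T

theorem ofFn_append_last {α : Type*} {k : ℕ} (f : Fin (k + 1) → α) :
    List.ofFn (fun i : Fin k => f i.castSucc) ++ [f (Fin.last k)] = List.ofFn f := by
  rw [List.ofFn_succ', List.concat_eq_append]

theorem isPyrFact_ofFn {T : Set S} {k : ℕ} {f : Fin (k + 1) → Trace R}
    (hf : ∀ i : Fin (k + 1), f i ∈ factorSet R a T k i) :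
    IsPyrFact a (List.ofFn f).prod
      (List.ofFn (fun i : Fin k => f i.castSucc), f (Fin.last k)) := by
  refine ⟨?_, ?_, ?_⟩
  · rw [List.forall_mem_ofFn_iff]
    intro i
    simpa [factorSet] using hf i.castSucc
  · have := hf (Fin.last k)
    simp only [factorSet, Fin.val_last, lt_irrefl, if_false] at this
    exact this.1
  · rw [← ofFn_append_last]
    simp

section
variable (hrefl : ∀ a, R a a) (hsymm : ∀ a b, R a b → R b a)
include hrefl hsymm

theorem ofFn_pyrU {x : Trace R} {k : ℕ} (h : count a x = k) :
    List.ofFn (fun i : Fin (k + 1) => pyrU a i x) = (pyrFact a x).1 ++ [(pyrFact a x).2] := by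
  have hk : (pyrFact a x).1.length = k := (pyrK_eq_count hrefl hsymm x).trans h
  refine List.ext_getElem (by simp [hk]) fun i hi hi' => ?_
  simp only [List.getElem_ofFn, pyrU]
  rw [List.getD_eq_getElem _ _ hi']

/-- The factors `U_0, …, U_k` determine a trace with `k` occurrences of `a`, and they may be
prescribed freely in the sets `factorSet`. -/
theorem mem_maxIn_count_pyrU_iff {T : Set S} (haT : a ∈ T) {k : ℕ} {x : Trace R}
    {f : Fin (k + 1) → Trace R} :
    (x ∈ maxIn R Set.univ T ∩ {x | count a x = k} ∧ (fun i : Fin (k + 1) => pyrU a i x) = f) ↔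
      (∀ i : Fin (k + 1), f i ∈ factorSet R a T k i) ∧ x = (List.ofFn f).prod := by
  constructor
  · rintro ⟨⟨⟨-, hT⟩, hk⟩, rfl⟩
    have hl := ofFn_pyrU hrefl hsymm hk
    have hF := isPyrFact_pyrFact (a := a) hrefl hsymm x
    refine ⟨fun i => ?_, ?_⟩
    · have hk' : (pyrFact a x).1.length = k := (pyrK_eq_count hrefl hsymm x).trans hk
      change pyrU a i x ∈ _
      unfold factorSet pyrU
      split_ifs with hi
      · rw [List.getD_append _ _ _ _ (by omega), List.getD_eq_getElem _ _ (by omega)]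
        exact hF.1 _ (List.getElem_mem _)
      · have : (i : ℕ) = k := by omega
        rw [List.getD_append_right _ _ _ _ (by omega), this, hk']
        simpa using ⟨hF.2.1, (maxLetters_subset_iff hrefl hsymm haT hF).1 hT⟩
    · rw [hl]
      simpa using hF.2.2
  · rintro ⟨hf, rfl⟩
    have hF := isPyrFact_ofFn hf
    have hP := isPyrFact_unique hrefl hsymm
      (isPyrFact_pyrFact (a := a) hrefl hsymm (List.ofFn f).prod) hF
    have hlast := hf (Fin.last k)
    simp only [factorSet, Fin.val_last, lt_irrefl, if_false] at hlast
    have hk : count a (List.ofFn f).prod = k := by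
      rw [← pyrK_eq_count hrefl hsymm, pyrK, hP]
      simp
    refine ⟨⟨⟨sub_univ _, (maxLetters_subset_iff hrefl hsymm haT hF).2 hlast.2⟩, hk⟩, ?_⟩
    apply List.ofFn_injective
    rw [ofFn_pyrU hrefl hsymm hk, hP, ofFn_append_last]

end

/-! ### Laws of the factors -/

theorem inv_mul_mul_cancel_right {c : ENNReal} (h0 : c ≠ 0) (ht : c ≠ ⊤) (x y : ENNReal) :
    (x * c)⁻¹ * (y * c) = x⁻¹ * y := by
  rw [ENNReal.mul_inv (Or.inr ht) (Or.inr h0), mul_mul_mul_comm, ENNReal.inv_mul_cancel h0 ht,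
    mul_one]

theorem map_cond_preimage {Ω α : Type*} [MeasurableSpace Ω] [MeasurableSpace α] (P : Measure Ω)
    {X : Ω → α} (hX : Measurable X) {E : Set α} (hE : MeasurableSet E) :
    (P[|X ⁻¹' E]).map X = (P.map X)[|E] := by
  ext t ht
  rw [Measure.map_apply hX ht, cond_apply (hX hE), cond_apply hE, Measure.map_apply hX hE,
    Measure.map_apply hX (hE.inter ht), Set.preimage_inter]

theorem lawB_eq [Fintype S] {p : ℝ} {A : Set S} (hA : 0 ≤ mobiusVal R A p) (hp : 0 ≤ p) :
    lawB R p A =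
      ENNReal.ofReal (mobiusVal R A p) • (weight R (ENNReal.ofReal p)).restrict (sub R A) := by
  refine Measure.ext fun C _ => ?_
  rw [lawB, Measure.sum_apply _ MeasurableSet.of_discrete, Measure.smul_apply,
    Measure.restrict_apply MeasurableSet.of_discrete, weight_apply,
    tsum_subtype (C ∩ sub R A) fun x => ENNReal.ofReal p ^ length x, smul_eq_mul,
    ← ENNReal.tsum_mul_left]
  refine (tsum_subtype (sub R A : Set (Trace R)) fun x => (ENNReal.ofReal
      (mobiusVal R A p * p ^ length x) • Measure.dirac x) C).trans ?_
  refine tsum_congr fun x => ?_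
  by_cases h1 : x ∈ sub R A <;> by_cases h2 : x ∈ C <;>
    simp [h1, h2, ENNReal.ofReal_mul hA, ENNReal.ofReal_pow hp]

/-- Normalizing twice amounts to normalizing once: the factor `μ_A(p)` disappears. -/
theorem lawD_eq [Fintype S] {p : ℝ} {A : Set S} (T : Set S) (hA : 0 < mobiusVal R A p)
    (hp : 0 ≤ p) : lawD R p A T = (weight R (ENNReal.ofReal p))[|maxIn R A T] := by
  refine Measure.ext fun C _ => ?_
  have hinter : {x : Trace R | maxLetters x ⊆ T} ∩ sub R A = maxIn R A T := Set.inter_comm _ _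
  rw [lawD, lawB_eq hA.le hp, cond_apply MeasurableSet.of_discrete,
    cond_apply MeasurableSet.of_discrete]
  simp only [Measure.smul_apply, smul_eq_mul, Measure.restrict_apply MeasurableSet.of_discrete]
  rw [Set.inter_right_comm, hinter, mul_comm, mul_comm _ (weight R _ (maxIn R A T)), mul_comm,
    mul_comm _ (weight R _ (maxIn R A T ∩ C)),
    inv_mul_mul_cancel_right (by simpa using hA) ENNReal.ofReal_ne_top]

theorem pow_length_prod (l : List (Trace R)) :
    q ^ length l.prod = (l.map fun x => q ^ length x).prod := by
  induction l with
  | nil => simp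
  | cons x l ih => simp [pow_add, ih]

section
variable (hrefl : ∀ a, R a a) (hsymm : ∀ a b, R a b → R b a)
include hrefl hsymm

theorem weight_image_mul_letter (B : Set (Trace R)) :
    weight R q ((· * letter R a) '' B) = weight R q B * q := by
  rw [weight_eq_mul (A := B) (B := {letter R a}) ⟨?_, ?_, ?_⟩, weight_singleton, length_letter,
    pow_one]
  · rintro ⟨v, w⟩ ⟨hv, rfl⟩
    exact ⟨v, hv, rfl⟩
  · rintro ⟨v, w⟩ ⟨_, rfl⟩ ⟨v', w'⟩ ⟨_, rfl⟩ h
    exact Prod.ext (mul_letter_cancel hrefl hsymm h) rfl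
  · rintro _ ⟨v, hv, rfl⟩
    exact ⟨(v, letter R a), ⟨hv, rfl⟩, rfl⟩

theorem map_removeLast_cond_Pyr (h0 : q ≠ 0) (ht : q ≠ ⊤) :
    ((weight R q)[|Pyr R a]).map (removeLast a) = (weight R q)[|maxIn R {a}ᶜ (link R a)] := by
  refine Measure.ext fun C _ => ?_
  have hinter : Pyr R a ∩ removeLast a ⁻¹' C =
      (· * letter R a) '' (maxIn R {a}ᶜ (link R a) ∩ C) := by
    rw [Pyr_eq_image]
    ext u
    constructor
    · rintro ⟨⟨z, hz, rfl⟩, hu⟩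
      rw [Set.mem_preimage, removeLast_mul_letter hrefl hsymm] at hu
      exact ⟨z, ⟨hz, hu⟩, rfl⟩
    · rintro ⟨z, ⟨hz, hu⟩, rfl⟩
      exact ⟨⟨z, hz, rfl⟩, by simpa [removeLast_mul_letter hrefl hsymm] using hu⟩
  rw [Measure.map_apply Measurable.of_discrete MeasurableSet.of_discrete,
    cond_apply MeasurableSet.of_discrete, cond_apply MeasurableSet.of_discrete, hinter,
    Pyr_eq_image, weight_image_mul_letter hrefl hsymm, weight_image_mul_letter hrefl hsymm,
    inv_mul_mul_cancel_right h0 ht]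

theorem prod_weight_factorSet {T : Set S} (haT : a ∈ T) (k : ℕ) :
    ∏ i : Fin (k + 1), weight R q (factorSet R a T k i) =
      weight R q (maxIn R Set.univ T ∩ {x | count a x = k}) := by
  have h := weight_maxIn_inter_count (q := q) hrefl hsymm (A := {a}ᶜ) (a := a) (by simp) haT k
  rw [show insert a ({a}ᶜ : Set S) = Set.univ by ext b; simp [em]] at h
  rw [h, Fin.prod_univ_castSucc]
  simp [factorSet, Pyr_eq_image, weight_image_mul_letter hrefl hsymm]

theorem weight_inter_pyrU_eq {T : Set S} (haT : a ∈ T) {k : ℕ} (f : Fin (k + 1) → Trace R) :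
    weight R q ((maxIn R Set.univ T ∩ {x | count a x = k}) ∩
        (fun x (i : Fin (k + 1)) => pyrU a i x) ⁻¹' {f}) =
      ∏ i : Fin (k + 1), weight R q (factorSet R a T k i ∩ {f i}) := by
  by_cases hf : ∀ i : Fin (k + 1), f i ∈ factorSet R a T k i
  · have hset : (maxIn R Set.univ T ∩ {x | count a x = k}) ∩
        (fun x (i : Fin (k + 1)) => pyrU a i x) ⁻¹' {f} = {(List.ofFn f).prod} := by
      ext x
      exact (mem_maxIn_count_pyrU_iff hrefl hsymm haT).trans (and_iff_right hf)
    rw [hset, weight_singleton, pow_length_prod, List.map_ofFn, List.prod_ofFn]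
    refine Finset.prod_congr rfl fun i _ => ?_
    rw [Set.inter_eq_right.2 (Set.singleton_subset_iff.2 (hf i)), weight_singleton]
    rfl
  · have hset : (maxIn R Set.univ T ∩ {x | count a x = k}) ∩
        (fun x (i : Fin (k + 1)) => pyrU a i x) ⁻¹' {f} = ∅ :=
      Set.eq_empty_of_forall_notMem fun x hx =>
        hf ((mem_maxIn_count_pyrU_iff hrefl hsymm haT).1 hx).1
    obtain ⟨i, hi⟩ := not_forall.1 hf
    rw [hset, measure_empty, Finset.prod_eq_zero (Finset.mem_univ i)]
    rw [Set.inter_singleton_eq_empty.2 hi, measure_empty]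

/-- Given the number `k` of occurrences of `a`, the joint law of the factors `U_0, …, U_k` is a
product measure. -/
theorem map_pyrU_cond [Countable S] {T : Set S} (haT : a ∈ T) {k : ℕ}
    (h0 : ∀ i : Fin (k + 1), weight R q (factorSet R a T k i) ≠ 0)
    (ht : ∀ i : Fin (k + 1), weight R q (factorSet R a T k i) ≠ ⊤) :
    ((weight R q)[|maxIn R Set.univ T ∩ {x | count a x = k}]).map
        (fun x (i : Fin (k + 1)) => pyrU a i x) =
      Measure.pi fun i : Fin (k + 1) => (weight R q)[|factorSet R a T k i] := by
  have hprob := fun i : Fin (k + 1) => cond_isProbabilityMeasure_of_finite (h0 i) (ht i)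
  refine Measure.ext_of_singleton fun f => ?_
  rw [Measure.map_apply Measurable.of_discrete (measurableSet_singleton f),
    cond_apply MeasurableSet.of_discrete, Measure.pi_singleton,
    weight_inter_pyrU_eq hrefl hsymm haT, ← prod_weight_factorSet hrefl hsymm haT,
    ENNReal.prod_inv_distrib (fun i _ j _ _ => Or.inl (h0 i)), ← Finset.prod_mul_distrib]
  refine Finset.prod_congr rfl fun i _ => ?_
  rw [cond_apply MeasurableSet.of_discrete]

end

end TraceMonoid

end

open TraceMonoid in
theorem theorem1 {S : Type*} [Fintype S] (R : S → S → Prop)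
    (hrefl : ∀ a, R a a) (hsymm : ∀ a b, R a b → R b a)
    (p : ℝ) (hp0 : 0 < p) (hp1 : p < minRoot R) (a : S) :
    0 < mobiusVal R {a}ᶜ p ∧
    p * mobiusVal R (link R a)ᶜ p / mobiusVal R {a}ᶜ p
      = 1 - mobiusVal R Set.univ p / mobiusVal R {a}ᶜ p ∧
    (∀ x : Trace R, (∃! f, IsPyrFact a x f) ∧ pyrK a x = count a x) ∧
    ∀ r : ℝ, r = p * mobiusVal R (link R a)ᶜ p / mobiusVal R {a}ᶜ p →
    ∀ T : Set S, a ∈ T →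
      IsProbabilityMeasure (lawB R p Set.univ) ∧
      IsProbabilityMeasure (lawD R p Set.univ T) ∧
      ∀ {Ω : Type*} [MeasurableSpace Ω] (P : Measure Ω) [IsProbabilityMeasure P]
        (ξ : Ω → Trace R), Measurable ξ → P.map ξ = lawD R p Set.univ T →
        (∀ k : ℕ, P.real {ω | pyrK a (ξ ω) = k} = (1 - r) * r ^ k) ∧
        ∀ k : ℕ,
          iIndepFun (fun (i : Fin (k + 1)) ω => pyrU a i (ξ ω))
            (P[|{ω | pyrK a (ξ ω) = k}]) ∧
          (∀ i < k, (P[|{ω | pyrK a (ξ ω) = k}]).map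
              (fun ω => removeLast a (pyrU a i (ξ ω))) = lawD R p {a}ᶜ (link R a)) ∧
          (P[|{ω | pyrK a (ξ ω) = k}]).map (fun ω => pyrU a k (ξ ω)) = lawD R p {a}ᶜ T := by
  have hpp : p ∈ Set.Icc 0 p := ⟨hp0.le, le_rfl⟩
  have hpos : ∀ B : Set S, ∀ t ∈ Set.Icc 0 p, 0 < mobiusVal R B t := fun B =>
    mobiusVal_pos_of_subset hsymm Set.univ p (mobiusVal_univ_pos_of_lt_minRoot hp1) B
      (Set.subset_univ B)
  have hμ : ∀ B : Set S, 0 < mobiusVal R B p := fun B => hpos B p hpp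
  have hμa := hμ {a}ᶜ
  have hμl := hμ (link R a)ᶜ
  have hμu := hμ Set.univ
  have hins : insert a ({a}ᶜ : Set S) = Set.univ := by ext b; simp [em]
  have hdiff : ({a}ᶜ : Set S) \ link R a = (link R a)ᶜ := by
    ext b
    refine ⟨fun h => h.2, fun h => ⟨?_, h⟩⟩
    rintro rfl
    exact h (hrefl b)
  have hrec := mobiusVal_insert hsymm (A := {a}ᶜ) (a := a) (by simp) p
  rw [hins, hdiff] at hrec
  have hr1 : p * mobiusVal R (link R a)ᶜ p / mobiusVal R {a}ᶜ p
      = 1 - mobiusVal R Set.univ p / mobiusVal R {a}ᶜ p := by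
    rw [hrec]
    field_simp
    ring
  refine ⟨hμa, hr1, fun x => ⟨?_, pyrK_eq_count hrefl hsymm x⟩, ?_⟩
  · exact ⟨_, isPyrFact_pyrFact hrefl hsymm x, fun g hg =>
      isPyrFact_unique hrefl hsymm hg (isPyrFact_pyrFact hrefl hsymm x)⟩
  intro r hr T haT
  have hrpos : 0 < r := by rw [hr]; positivity
  have hrlt : 0 < 1 - r := by
    rw [hr, hr1, sub_sub_cancel]
    positivity
  set q := ENNReal.ofReal p with hq
  have hq0 : q ≠ 0 := by simpa [hq] using hp0
  have hqt : q ≠ ⊤ := ENNReal.ofReal_ne_top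
  have hW : ∀ A B : Set S, weight R q (maxIn R A B) ≠ 0 ∧ weight R q (maxIn R A B) ≠ ⊤ := by
    intro A B
    rw [hq, weight_maxIn hrefl hsymm hp0.le (hpos A)]
    have := hμ A
    have := hμ (A \ B)
    refine ⟨?_, ENNReal.ofReal_ne_top⟩
    rw [Ne, ENNReal.ofReal_eq_zero, not_le]
    positivity
  -- The parameter `r` is the total weight of the pyramidal traces.
  have hρ : weight R q (maxIn R {a}ᶜ (link R a)) * q = ENNReal.ofReal r := by
    rw [hq, weight_maxIn hrefl hsymm hp0.le (hpos _), hdiff, ← ENNReal.ofReal_mul (by positivity),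
      hr]
    congr 1
    ring
  refine ⟨⟨?_⟩, ?_, ?_⟩
  · rw [lawB_eq hμu.le hp0.le, Measure.smul_apply, Measure.restrict_apply_univ,
      weight_sub hrefl hsymm _ p hp0.le (hpos _), smul_eq_mul, ENNReal.ofReal_inv_of_pos hμu]
    exact ENNReal.mul_inv_cancel (by simpa using hμu) ENNReal.ofReal_ne_top
  · rw [lawD_eq T hμu hp0.le]
    exact cond_isProbabilityMeasure_of_finite (hW _ _).1 (hW _ _).2
  intro Ω _ P _ ξ hξ hlaw
  rw [lawD_eq T hμu hp0.le] at hlaw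
  rw [lawD_eq _ hμa hp0.le, lawD_eq _ hμa hp0.le]
  have hE : ∀ k : ℕ, {ω | pyrK a (ξ ω) = k} = ξ ⁻¹' {x | count a x = k} := fun k => by
    ext ω
    simp [pyrK_eq_count hrefl hsymm]
  refine ⟨fun k => ?_, fun k => ?_⟩
  · have h1 := weight_maxIn_inter_count (q := q) hrefl hsymm (A := {a}ᶜ) (a := a) (by simp) haT k
    have h2 := weight_maxIn_insert (q := q) hrefl hsymm (A := {a}ᶜ) (a := a) (by simp) haT
    rw [hins, hρ] at h1 h2
    rw [hE, Measure.real, ← Measure.map_apply hξ MeasurableSet.of_discrete, hlaw,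
      cond_apply MeasurableSet.of_discrete, h1, h2,
      inv_mul_mul_cancel_right (hW _ _).1 (hW _ _).2, inv_inv, ← ENNReal.ofReal_one,
      ← ENNReal.ofReal_sub _ hrpos.le, ← ENNReal.ofReal_pow hrpos.le,
      ← ENNReal.ofReal_mul hrlt.le, ENNReal.toReal_ofReal (by positivity)]
  · have hF : ∀ i : Fin (k + 1), weight R q (factorSet R a T k i) ≠ 0 ∧
        weight R q (factorSet R a T k i) ≠ ⊤ := by
      intro i
      unfold factorSet
      split_ifs
      · rw [Pyr_eq_image, weight_image_mul_letter hrefl hsymm]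
        exact ⟨mul_ne_zero (hW _ _).1 hq0, ENNReal.mul_ne_top (hW _ _).2 hqt⟩
      · exact hW _ _
    have hprob := fun i : Fin (k + 1) => cond_isProbabilityMeasure_of_finite (hF i).1 (hF i).2
    have hU : ∀ i : ℕ, Measurable fun ω => pyrU a i (ξ ω) := fun i =>
      (Measurable.of_discrete (f := pyrU a i)).comp hξ
    have hUpi : Measurable fun ω (i : Fin (k + 1)) => pyrU a i (ξ ω) :=
      measurable_pi_lambda _ fun i => hU i
    have hjoint : (P[|{ω | pyrK a (ξ ω) = k}]).map (fun ω (i : Fin (k + 1)) => pyrU a i (ξ ω)) =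
        Measure.pi fun i : Fin (k + 1) => (weight R q)[|factorSet R a T k i] := by
      rw [← map_pyrU_cond hrefl hsymm haT (fun i => (hF i).1) (fun i => (hF i).2),
        ← cond_cond_eq_cond_inter' MeasurableSet.of_discrete MeasurableSet.of_discrete (hW _ _).2,
        ← hlaw, ← map_cond_preimage P hξ MeasurableSet.of_discrete, hE,
        Measure.map_map Measurable.of_discrete hξ]
      rfl
    have hmarg : ∀ i : Fin (k + 1), (P[|{ω | pyrK a (ξ ω) = k}]).map (fun ω => pyrU a i (ξ ω)) =
        (weight R q)[|factorSet R a T k i] := by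
      intro i
      rw [← (measurePreserving_eval (fun i : Fin (k + 1) =>
        (weight R q)[|factorSet R a T k i]) i).map_eq, ← hjoint,
        Measure.map_map (measurable_pi_apply i) hUpi]
      rfl
    have : IsProbabilityMeasure (P[|{ω | pyrK a (ξ ω) = k}]) := by
      have : IsProbabilityMeasure ((P[|{ω | pyrK a (ξ ω) = k}]).map
          (fun ω (i : Fin (k + 1)) => pyrU a i (ξ ω))) := by
        rw [hjoint]
        infer_instance
      exact Measure.isProbabilityMeasure_of_map (fun ω (i : Fin (k + 1)) => pyrU a i (ξ ω))
    refine ⟨?_, fun i hi => ?_, ?_⟩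
    · rw [iIndepFun_iff_map_fun_eq_pi_map fun i : Fin (k + 1) => (hU i).aemeasurable, hjoint]
      simp_rw [hmarg]
    · have h := hmarg ⟨i, by omega⟩
      simp only [factorSet, hi, if_true] at h
      rw [← map_removeLast_cond_Pyr hrefl hsymm hq0 hqt, ← h,
        Measure.map_map Measurable.of_discrete (hU i)]
      rfl
    · have h := hmarg (Fin.last k)
      simpa [factorSet] using h
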